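/- Let $X$ be a real Banach space, let $S_X$ and $B_X$ be its unit sphere and closed unit ball, and let $X^*$ be its dual. Suppose that there is a nonempty closed set $A\subseteq S_X$ such that: (i) the absolute convex hull of $A$ is dense in $B_X$; (ii) for every sufficiently small $\varepsilon>0$ there is $\varpi(\varepsilon)>0$ such that for every $x\in A$ there is $x^*_{x,\varepsilon}\in B_{X^*}$ with $$\forall z\in A:\quad \|z-x\|\ge \varepsilon \ \Longrightarrow\ x^*_{x,\varepsilon}(x)-\varpi(\varepsilon)\ \ge\ |x^*_{x,\varepsilon}(z)|.$$ Let $W\neq\{0\}$ be a real Banach space, let $\mathcal L(X,W)$ be the space of bounded linear operators from $X$ to $W$ with the operator norm, and let $\mathcal A\subseteq\mathcal L(X,W)$ be a closed linear subspace containing all bounded operators of finite rank. An operator $T\in\mathcal L(X,W)$ *attains strongly its norm on $A$* if $\|T\|=\sup_{x\in A}\|T(x)\|$ and there is $x_0\in A$ such that $\|T(x_0)\|=\sup_{x\in A}\|T(x)\|$ and $\|x_n-x_0\|\to0$ for every sequence $(x_n)\subseteq A$ with $\|T(x_n)\|\to\|T(x_0)\|$. A subset $P$ of a metric space $E$ is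 *porous* if there are $\lambda_0\in(0,1]$ and $r_0>0$ such that for all $x\in E$ and $r\in(0,r_0]$ there is $y\in E$ such that the open ball $B(y,\lambda_0 r)$ is contained in $B(x,r)\cap(E\setminus P)$; it is *$\sigma$-porous* if it is a countable union of porous sets. Then: (1) For every $S\in\mathcal L(X,W)$, the set $$\mathcal G(S)=\{T\in\mathcal A:\ S+T\ \text{attains strongly its norm on } A\}$$ is the complement of a $\sigma$-porous subset of $\mathcal A$. (2) For every $\varepsilon>0$ there is $\eta(\varepsilon)>0$ such that whenever $T\in\mathcal A$ with $\|T\|=1$ and $x\in A$ satisfy $\|T(x)\|>1-\eta(\varepsilon)$, there are $S\in\mathcal A$ with $\|S\|=1$ and $z\in A$ such that $$\|S(z)\|=1,\qquad \|x-z\|<\varepsilon\qquad\text{and}\qquad \|S-T\|<\varepsilon .$$ -/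

import Mathlib

open Set Filter Topology

/-- A subset `P` of a metric space `E` is porous if there are `c ∈ (0, 1]` and `r₀ > 0` such that
for all `x ∈ E` and `r ∈ (0, r₀]` some open ball `B(y, c r)` is contained in `B(x, r) \ P`. -/
def IsPorous {E : Type*} [MetricSpace E] (P : Set E) : Prop :=
  ∃ c : ℝ, 0 < c ∧ c ≤ 1 ∧ ∃ r₀ : ℝ, 0 < r₀ ∧ ∀ x : E, ∀ r : ℝ, 0 < r → r ≤ r₀ →
    ∃ y : E, Metric.ball y (c * r) ⊆ Metric.ball x r ∩ Pᶜ

/-- A set is `σ`-porous if it is a countable union of porous sets. -/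
def IsSigmaPorous {E : Type*} [MetricSpace E] (P : Set E) : Prop :=
  ∃ Q : ℕ → Set E, (∀ n, IsPorous (Q n)) ∧ P = ⋃ n, Q n

/-- `T` attains strongly its norm on `A` at `x₀`: the point `x₀` belongs to `A`, the map
`x ↦ ‖T x‖` attains its maximum on `A` at `x₀`, every sequence of `A` that is maximizing for this
map converges to `x₀`, and `‖T‖ = sup {‖T x‖ : x ∈ A}`. -/
structure AttainsStronglyNormAt {X W : Type*} [NormedAddCommGroup X] [NormedSpace ℝ X]
    [NormedAddCommGroup W] [NormedSpace ℝ W] (T : X →L[ℝ] W) (A : Set X) (x₀ : X) : Prop where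
  mem : x₀ ∈ A
  isMaxOn : IsMaxOn (fun x => ‖T x‖) A x₀
  strong : ∀ u : ℕ → X, (∀ n, u n ∈ A) →
    Tendsto (fun n => ‖T (u n)‖) atTop (𝓝 ‖T x₀‖) → Tendsto u atTop (𝓝 x₀)
  isLUB_norm : IsLUB ((fun x => ‖T x‖) '' A) ‖T‖

/-- `T` attains strongly its norm on `A` (at some point of `A`). -/
def AttainsStronglyNorm {X W : Type*} [NormedAddCommGroup X] [NormedSpace ℝ X]
    [NormedAddCommGroup W] [NormedSpace ℝ W] (T : X →L[ℝ] W) (A : Set X) : Prop :=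
  ∃ x₀ : X, AttainsStronglyNormAt T A x₀

/-! Strong attainment follows from norm gaps at scales tending to zero
(`attainsStronglyNorm_of_hasNormGap`). At one scale, failure of the gap is porous: a small rank-one
operator, built from the functional peaking at an almost norming point of `A`, creates a gap that
survives further perturbation (`isPorous_not_hasNormGap`). For (2), Baire's theorem makes strong
attainment dense; the same perturbation placed at the given `x` forces nearby attaining operators to
attain close to `x`. -/

theorem IsPorous.mono {E : Type*} [MetricSpace E] {P Q : Set E} (hQ : IsPorous Q) (h : P ⊆ Q) :
    IsPorous P := by
  obtain ⟨c, hc, hc1, r₀, hr₀, H⟩ := hQ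
  refine ⟨c, hc, hc1, r₀, hr₀, fun x r hr hr' => ?_⟩
  obtain ⟨y, hy⟩ := H x r hr hr'
  exact ⟨y, hy.trans (inter_subset_inter_right _ (compl_subset_compl.2 h))⟩

theorem IsPorous.isNowhereDense {E : Type*} [MetricSpace E] {P : Set E} (hP : IsPorous P) :
    IsNowhereDense P := by
  obtain ⟨c, hc, -, r₀, hr₀, H⟩ := hP
  rw [IsNowhereDense, eq_empty_iff_forall_notMem]
  intro x hx
  obtain ⟨r, hr, hxr⟩ := Metric.mem_nhds_iff.1 (mem_interior_iff_mem_nhds.1 hx)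
  have hs : 0 < min r r₀ := lt_min hr hr₀
  obtain ⟨y, hy⟩ := H x (min r r₀) hs (min_le_right _ _)
  have hy0 : y ∈ Metric.ball y (c * min r r₀) := Metric.mem_ball_self (mul_pos hc hs)
  have hyP : y ∈ closure P :=
    hxr (Metric.ball_subset_ball (min_le_left _ _) (hy hy0).1)
  obtain ⟨z, hzP, hz⟩ := Metric.mem_closure_iff.1 hyP _ (mul_pos hc hs)
  rw [dist_comm] at hz
  exact (hy hz).2 hzP

theorem IsSigmaPorous.dense_compl {E : Type*} [MetricSpace E] [CompleteSpace E] {P : Set E}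
    (hP : IsSigmaPorous P) : Dense Pᶜ := by
  obtain ⟨Q, hQ, rfl⟩ := hP
  have h : Dense (⋂ n, (closure (Q n))ᶜ) := dense_iInter_of_isOpen
    (fun n => isClosed_closure.isOpen_compl)
    fun n => interior_eq_empty_iff_dense_compl.1 (hQ n).isNowhereDense
  refine h.mono ?_
  rw [compl_iUnion]
  exact iInter_mono fun n => compl_subset_compl.2 subset_closure

section Operators

variable {X W : Type*} [NormedAddCommGroup X] [NormedSpace ℝ X]
  [NormedAddCommGroup W] [NormedSpace ℝ W] {A : Set X}

theorem nonempty_of_closedBall_subset_closure_absConvexHull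
    (hA : Metric.closedBall (0 : X) 1 ⊆ closure (absConvexHull ℝ A)) : A.Nonempty := by
  by_contra h
  rw [not_nonempty_iff_eq_empty] at h
  subst h
  simpa using hA (Metric.mem_closedBall_self zero_le_one)

/-- A bound for `‖T x‖` on `A` passes to the unit ball because its sublevel sets are closed and
absolutely convex. -/
theorem isLUB_opNorm_of_absConvexHull_dense (hAs : A ⊆ Metric.sphere (0 : X) 1)
    (hA : Metric.closedBall (0 : X) 1 ⊆ closure (absConvexHull ℝ A)) (T : X →L[ℝ] W) :
    IsLUB ((fun x => ‖T x‖) '' A) ‖T‖ := by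
  constructor
  · rintro _ ⟨x, hx, rfl⟩
    have : ‖x‖ = 1 := by simpa using hAs hx
    simpa [this] using T.le_opNorm x
  · intro m hm
    have hAm : ∀ x ∈ A, ‖T x‖ ≤ m := fun x hx => hm ⟨x, hx, rfl⟩
    obtain ⟨a, ha⟩ := nonempty_of_closedBall_subset_closure_absConvexHull hA
    have hm0 : 0 ≤ m := (norm_nonneg _).trans (hAm a ha)
    let p : Seminorm ℝ X := (normSeminorm ℝ W).comp (T : X →ₗ[ℝ] W)
    have hp : ∀ x, x ∈ p.closedBall 0 m ↔ ‖T x‖ ≤ m := fun x => by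
      rw [Seminorm.mem_closedBall_zero]; rfl
    have hclosed : IsClosed (p.closedBall 0 m) := by
      have : p.closedBall 0 m = {x | ‖T x‖ ≤ m} := Set.ext hp
      rw [this]
      exact isClosed_le T.continuous.norm continuous_const
    have hsub : Metric.closedBall (0 : X) 1 ⊆ p.closedBall 0 m :=
      hA.trans <| closure_minimal
        (absConvexHull_min (fun x hx => (hp x).2 (hAm x hx))
          ⟨p.balanced_closedBall_zero m, p.convex_closedBall 0 m⟩) hclosed
    refine T.opNorm_le_of_unit_norm hm0 fun x hx => (hp x).1 (hsub ?_)
    simp [hx]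

/-- Some point of `A` beats, by a positive margin, all points of `A` at distance at least `ε`
from it. -/
def HasNormGap (T : X →L[ℝ] W) (A : Set X) (ε : ℝ) : Prop :=
  ∃ x ∈ A, ∃ α : ℝ, 0 < α ∧ ∀ z ∈ A, ε ≤ ‖z - x‖ → ‖T z‖ ≤ ‖T x‖ - α

/-- Each gap eventually confines every maximizing sequence to an `ε n`-ball about one fixed point,
so such sequences are Cauchy and share their limit. -/
theorem attainsStronglyNorm_of_hasNormGap [CompleteSpace X] (hAc : IsClosed A) {T : X →L[ℝ] W}
    (hT : IsLUB ((fun x => ‖T x‖) '' A) ‖T‖) (hne : A.Nonempty) {ε : ℕ → ℝ}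
    (hε : Tendsto ε atTop (𝓝 0)) (hgap : ∀ n, HasNormGap T A (ε n)) :
    AttainsStronglyNorm T A := by
  choose x hxA α hα hx using hgap
  have hle : ∀ z ∈ A, ‖T z‖ ≤ ‖T‖ := fun z hz => hT.1 ⟨z, hz, rfl⟩
  have hnear : ∀ u : ℕ → X, (∀ k, u k ∈ A) → Tendsto (fun k => ‖T (u k)‖) atTop (𝓝 ‖T‖) →
      ∀ n, ∀ᶠ k in atTop, ‖u k - x n‖ < ε n := by
    intro u hu hTu n
    have : ‖T (x n)‖ - α n < ‖T‖ := by linarith [hle _ (hxA n), hα n]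
    filter_upwards [hTu.eventually (lt_mem_nhds this)] with k hk
    by_contra! h
    linarith [hx n (u k) (hu k) h]
  obtain ⟨v, -, -, hv, hvA⟩ := hT.exists_seq_monotone_tendsto (hne.image _)
  choose u huA hu using hvA
  have hTu : Tendsto (fun k => ‖T (u k)‖) atTop (𝓝 ‖T‖) := by
    simpa only [hu] using hv
  have hcauchy : CauchySeq u := by
    rw [Metric.cauchySeq_iff]
    intro δ hδ
    obtain ⟨n, hn⟩ := (hε.eventually (gt_mem_nhds (half_pos hδ))).exists
    obtain ⟨N, hN⟩ := eventually_atTop.1 (hnear u huA hTu n)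
    refine ⟨N, fun i hi j hj => ?_⟩
    have h1 := hN i hi
    have h2 := hN j hj
    rw [← dist_eq_norm] at h1 h2
    linarith [dist_triangle_right (u i) (u j) (x n)]
  obtain ⟨x₀, hx₀⟩ := cauchySeq_tendsto_of_complete hcauchy
  have hx₀A : x₀ ∈ A := hAc.mem_of_tendsto hx₀ (Eventually.of_forall huA)
  have hTx₀ : ‖T x₀‖ = ‖T‖ :=
    tendsto_nhds_unique ((T.continuous.norm.tendsto x₀).comp hx₀) hTu
  refine ⟨x₀, hx₀A, fun z hz => ?_, fun w hwA hw => ?_, hT⟩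
  · simpa [hTx₀] using hle z hz
  · rw [hTx₀] at hw
    rw [Metric.tendsto_atTop]
    intro δ hδ
    obtain ⟨n, hn⟩ := (hε.eventually (gt_mem_nhds (half_pos hδ))).exists
    obtain ⟨k, hk⟩ := (hnear (fun _ => x₀) (fun _ => hx₀A) (by simp [hTx₀]) n).exists
    obtain ⟨N, hN⟩ := eventually_atTop.1 (hnear w hwA hw n)
    refine ⟨N, fun i hi => ?_⟩
    have h1 := hN i hi
    rw [← dist_eq_norm] at h1 hk
    linarith [dist_triangle_right (w i) x₀ (x n)]

theorem exists_rankOne_perturbation [Nontrivial W] (T : X →L[ℝ] W) (x : X) (f : X →L[ℝ] ℝ) :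
    ∃ F : X →L[ℝ] W, FiniteDimensional ℝ (LinearMap.range (F : X →ₗ[ℝ] W)) ∧ ‖F‖ = ‖f‖ ∧
      (∀ z, ‖F z‖ = |f z|) ∧ ∀ ρ : ℝ, ‖T x‖ + ρ * f x ≤ ‖(T + ρ • F) x‖ := by
  -- Pointing `F` along `T x` makes the two norms add at `x`; any unit vector serves if `T x = 0`.
  obtain ⟨w, hw, hTw⟩ : ∃ w : W, ‖w‖ = 1 ∧ T x = ‖T x‖ • w := by
    by_cases h : T x = 0
    · obtain ⟨w, hw⟩ := exists_norm_eq W zero_le_one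
      exact ⟨w, hw, by simp [h]⟩
    · have h' : ‖T x‖ ≠ 0 := norm_ne_zero_iff.2 h
      exact ⟨‖T x‖⁻¹ • T x, by simp [norm_smul, h'], by rw [smul_inv_smul₀ h']⟩
  refine ⟨f.smulRight w, ?_, by simp [hw], fun z => by simp [norm_smul, hw], fun ρ => ?_⟩
  · refine Submodule.finiteDimensional_of_le (S₂ := ℝ ∙ w) ?_
    rintro _ ⟨z, rfl⟩
    exact Submodule.smul_mem _ _ (Submodule.mem_span_singleton_self w)
  · have : (T + ρ • f.smulRight w) x = (‖T x‖ + ρ * f x) • w := by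
      rw [add_smul, ← hTw]
      simp [mul_smul]
    rw [this, norm_smul, hw, mul_one]
    exact le_abs_self _

theorem isPorous_not_hasNormGap [Nontrivial W] (hAs : A ⊆ Metric.sphere (0 : X) 1)
    (hA : Metric.closedBall (0 : X) 1 ⊆ closure (absConvexHull ℝ A))
    {𝒜 : Submodule ℝ (X →L[ℝ] W)}
    (h𝒜 : ∀ F : X →L[ℝ] W, FiniteDimensional ℝ (LinearMap.range (F : X →ₗ[ℝ] W)) → F ∈ 𝒜)
    (S : X →L[ℝ] W) {ε ϖ : ℝ} (hϖ : 0 < ϖ)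
    (hsep : ∀ x ∈ A, ∃ f : X →L[ℝ] ℝ, ‖f‖ ≤ 1 ∧ ∀ z ∈ A, ε ≤ ‖z - x‖ → |f z| ≤ f x - ϖ) :
    IsPorous {T : 𝒜 | ¬ HasNormGap (S + (T : X →L[ℝ] W)) A ε} := by
  have hle : ∀ (R : X →L[ℝ] W), ∀ z ∈ A, ‖R z‖ ≤ ‖R‖ := fun R z hz =>
    (isLUB_opNorm_of_absConvexHull_dense hAs hA R).1 ⟨z, hz, rfl⟩
  -- The perturbation gains `ϖ r / 2`; near-maximality of `x` costs `ϖ r / 4` and moving within the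
  -- small ball costs `2 c r ≤ ϖ r / 8`, leaving a gap of `ϖ r / 8`.
  have hc : 0 < min (ϖ / 16) (1 / 2) := by positivity
  refine ⟨min (ϖ / 16) (1 / 2), hc, (min_le_right _ _).trans (by norm_num), 1, one_pos,
    fun T r hr _ => ?_⟩
  set c := min (ϖ / 16) (1 / 2)
  have hc1 : c * r ≤ ϖ / 16 * r := mul_le_mul_of_nonneg_right (min_le_left _ _) hr.le
  have hc2 : c * r ≤ 1 / 2 * r := mul_le_mul_of_nonneg_right (min_le_right _ _) hr.le
  have hϖr : 0 < ϖ * r := mul_pos hϖ hr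
  obtain ⟨_, ⟨x, hxA, rfl⟩, hx, -⟩ :=
    (isLUB_opNorm_of_absConvexHull_dense hAs hA (S + (T : X →L[ℝ] W))).exists_between
      (sub_lt_self _ (show 0 < ϖ * r / 4 by positivity))
  obtain ⟨f, hf, hfsep⟩ := hsep x hxA
  obtain ⟨F, hFfin, hFf, hFz, hFx⟩ := exists_rankOne_perturbation (S + (T : X →L[ℝ] W)) x f
  have hFr := hFx (r / 2)
  refine ⟨T + (r / 2) • ⟨F, h𝒜 F hFfin⟩, fun R hR => ?_⟩
  rw [Metric.mem_ball, dist_eq_norm] at hR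
  replace hR : ‖(R : X →L[ℝ] W) - (T + (r / 2) • F)‖ < c * r := hR
  have hFn : ‖(r / 2) • F‖ ≤ r / 2 := by
    rw [norm_smul, Real.norm_of_nonneg (by positivity)]
    exact mul_le_of_le_one_right (by positivity) (hFf.trans_le hf)
  refine ⟨?_, ?_⟩
  · rw [Metric.mem_ball, dist_eq_norm]
    calc ‖(R : X →L[ℝ] W) - T‖ = ‖((R : X →L[ℝ] W) - (T + (r / 2) • F)) + (r / 2) • F‖ := by
          congr 1; abel
      _ ≤ _ := norm_add_le _ _
      _ < r := by linarith
  · have hdiff : ∀ z ∈ A,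
        ‖(S + (R : X →L[ℝ] W)) z - (S + (T : X →L[ℝ] W) + (r / 2) • F) z‖ ≤ c * r := by
      intro z hz
      have := hle ((R : X →L[ℝ] W) - (T + (r / 2) • F)) z hz
      have e : (S + (R : X →L[ℝ] W)) z - (S + (T : X →L[ℝ] W) + (r / 2) • F) z =
          ((R : X →L[ℝ] W) - (T + (r / 2) • F)) z := by
        simp only [add_apply, sub_apply]
        abel
      rw [e]
      exact this.trans hR.le
    simp only [mem_compl_iff, mem_ofPred_eq, not_not]
    refine ⟨x, hxA, ϖ * r / 8, by positivity, fun z hz hzx => ?_⟩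
    have h1 := (norm_sub_norm_le _ _).trans (hdiff z hz)
    have h2 := (norm_sub_norm_le _ _).trans ((norm_sub_rev _ _).trans_le (hdiff x hxA))
    have h3 : ‖(S + (T : X →L[ℝ] W) + (r / 2) • F) z‖ ≤
        ‖S + (T : X →L[ℝ] W)‖ + r / 2 * |f z| := by
      refine (norm_add_le _ _).trans (add_le_add (hle _ z hz) ?_)
      change ‖(r / 2) • F z‖ ≤ _
      rw [norm_smul, hFz, Real.norm_of_nonneg (by positivity : 0 ≤ r / 2)]
    have h4 := mul_le_mul_of_nonneg_left (hfsep z hz hzx) (by positivity : 0 ≤ r / 2)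
    linarith

theorem isSigmaPorous_compl_attainsStronglyNorm [CompleteSpace X] [Nontrivial W]
    (hAs : A ⊆ Metric.sphere (0 : X) 1) (hAc : IsClosed A)
    (hA : Metric.closedBall (0 : X) 1 ⊆ closure (absConvexHull ℝ A))
    (hsep : ∃ ε₀ : ℝ, 0 < ε₀ ∧ ∀ ε : ℝ, 0 < ε → ε < ε₀ →
      ∃ ϖ : ℝ, 0 < ϖ ∧ ∀ x ∈ A, ∃ f : X →L[ℝ] ℝ, ‖f‖ ≤ 1 ∧
        ∀ z ∈ A, ε ≤ ‖z - x‖ → |f z| ≤ f x - ϖ)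
    {𝒜 : Submodule ℝ (X →L[ℝ] W)}
    (h𝒜 : ∀ F : X →L[ℝ] W, FiniteDimensional ℝ (LinearMap.range (F : X →ₗ[ℝ] W)) → F ∈ 𝒜)
    (S : X →L[ℝ] W) :
    IsSigmaPorous {T : 𝒜 | AttainsStronglyNorm (S + (T : X →L[ℝ] W)) A}ᶜ := by
  obtain ⟨ε₀, hε₀, H⟩ := hsep
  obtain ⟨ε, -, hε, hlim⟩ := exists_seq_strictAnti_tendsto' hε₀
  -- σ-porosity asks for equality with the union, hence the intersection.
  refine ⟨fun n => {T : 𝒜 | AttainsStronglyNorm (S + (T : X →L[ℝ] W)) A}ᶜ ∩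
    {T : 𝒜 | ¬ HasNormGap (S + (T : X →L[ℝ] W)) A (ε n)}, fun n => ?_, ?_⟩
  · obtain ⟨ϖ, hϖ, hf⟩ := H (ε n) (hε n).1 (hε n).2
    exact (isPorous_not_hasNormGap hAs hA h𝒜 S hϖ hf).mono inter_subset_right
  · rw [← inter_iUnion, eq_comm, inter_eq_left]
    intro T hT
    by_contra hgap
    simp only [mem_iUnion, mem_ofPred_eq, not_exists, not_not] at hgap
    exact hT (attainsStronglyNorm_of_hasNormGap hAc
      (isLUB_opNorm_of_absConvexHull_dense hAs hA _)
      (nonempty_of_closedBall_subset_closure_absConvexHull hA) hlim hgap)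

theorem exists_normAttaining_near [Nontrivial W] (hAs : A ⊆ Metric.sphere (0 : X) 1)
    {𝒜 : Submodule ℝ (X →L[ℝ] W)}
    (h𝒜 : ∀ F : X →L[ℝ] W, FiniteDimensional ℝ (LinearMap.range (F : X →ₗ[ℝ] W)) → F ∈ 𝒜)
    (hdense : Dense {T : 𝒜 | AttainsStronglyNorm (T : X →L[ℝ] W) A})
    {ε ϖ : ℝ} (hε : 0 < ε) (hϖ : 0 < ϖ)
    (hsep : ∀ x ∈ A, ∃ f : X →L[ℝ] ℝ, ‖f‖ ≤ 1 ∧ ∀ z ∈ A, ε ≤ ‖z - x‖ → |f z| ≤ f x - ϖ) :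
    ∃ η : ℝ, 0 < η ∧ ∀ T ∈ 𝒜, ‖T‖ = 1 → ∀ x ∈ A, 1 - η < ‖T x‖ →
      ∃ S ∈ 𝒜, ‖S‖ = 1 ∧ ∃ z ∈ A, ‖S z‖ = 1 ∧ ‖x - z‖ < ε ∧ ‖S - T‖ < ε := by
  have hle : ∀ (R : X →L[ℝ] W), ∀ z ∈ A, ‖R z‖ ≤ ‖R‖ := by
    intro R z hz
    have : ‖z‖ = 1 := by simpa using hAs hz
    simpa [this] using R.le_opNorm z
  obtain ⟨ρ, hρ, hρε, hρ1⟩ : ∃ ρ : ℝ, 0 < ρ ∧ ρ ≤ ε / 8 ∧ ρ ≤ 1 / 4 :=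
    ⟨min (ε / 8) (1 / 4), by positivity, min_le_left _ _, min_le_right _ _⟩
  -- Attainment far from `x` would give `ρ * ϖ < 3 * η`. Also `ρ + η ≤ 1 / 2` keeps `R` nonzero, and
  -- normalizing at most doubles the error, to `2 * (ρ + η) < ε`.
  obtain ⟨η, hη, hηϖ, hηρ⟩ : ∃ η : ℝ, 0 < η ∧ η ≤ ρ * ϖ / 4 ∧ η ≤ ρ :=
    ⟨min (ρ * ϖ / 4) ρ, by positivity, min_le_left _ _, min_le_right _ _⟩
  refine ⟨η, hη, fun T hT hT1 x hx hTx => ?_⟩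
  obtain ⟨f, hf, hfsep⟩ := hsep x hx
  obtain ⟨F, hFfin, hFf, hFz, hFx⟩ := exists_rankOne_perturbation T x f
  have hFρ := hFx ρ
  obtain ⟨R, ⟨z, hz⟩, hR⟩ := Metric.dense_iff.1 hdense
    ⟨T + ρ • F, 𝒜.add_mem hT (𝒜.smul_mem ρ (h𝒜 F hFfin))⟩ η hη |>.imp fun _ h => h.symm
  rw [Metric.mem_ball, dist_eq_norm] at hR
  replace hR : ‖(R : X →L[ℝ] W) - (T + ρ • F)‖ < η := hR
  have hzR : ‖(R : X →L[ℝ] W) z‖ = ‖(R : X →L[ℝ] W)‖ :=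
    le_antisymm (hle _ z hz.mem) (hz.isLUB_norm.2 (by
      rintro _ ⟨y, hy, rfl⟩
      exact hz.isMaxOn hy))
  have hFn : ‖ρ • F‖ ≤ ρ := by
    rw [norm_smul, Real.norm_of_nonneg hρ.le]
    exact mul_le_of_le_one_right hρ.le (hFf.trans_le hf)
  have hRT : ‖(R : X →L[ℝ] W) - T‖ < ρ + η := by
    calc ‖(R : X →L[ℝ] W) - T‖ = ‖((R : X →L[ℝ] W) - (T + ρ • F)) + ρ • F‖ := by
          congr 1; abel
      _ ≤ _ := norm_add_le _ _
      _ < ρ + η := by linarith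
  have habs : |‖(R : X →L[ℝ] W)‖ - 1| < ρ + η := by
    rw [← hT1]
    exact (abs_norm_sub_norm_le _ _).trans_lt hRT
  have hRpos : 0 < ‖(R : X →L[ℝ] W)‖ := by linarith [(abs_lt.1 habs).1]
  refine ⟨‖(R : X →L[ℝ] W)‖⁻¹ • (R : X →L[ℝ] W), 𝒜.smul_mem _ R.2, ?_, z, hz.mem, ?_, ?_, ?_⟩
  · rw [norm_smul, norm_inv, norm_norm, inv_mul_cancel₀ hRpos.ne']
  · rw [smul_apply, norm_smul, norm_inv, norm_norm, hzR,
      inv_mul_cancel₀ hRpos.ne']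
  · by_contra! hfar
    rw [norm_sub_rev] at hfar
    have hdiff : ∀ y ∈ A, ‖(R : X →L[ℝ] W) y - (T + ρ • F) y‖ < η := fun y hy =>
      (hle ((R : X →L[ℝ] W) - (T + ρ • F)) y hy).trans_lt hR
    have h1 := (norm_sub_norm_le _ _).trans_lt (hdiff z hz.mem)
    have h2 := (norm_sub_norm_le _ _).trans_lt ((norm_sub_rev _ _).trans_lt (hdiff x hx))
    have h3 : ‖(T + ρ • F) z‖ ≤ 1 + ρ * |f z| := by
      refine (norm_add_le _ _).trans (add_le_add ((hle _ z hz.mem).trans hT1.le) ?_)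
      change ‖ρ • F z‖ ≤ _
      rw [norm_smul, hFz, Real.norm_of_nonneg hρ.le]
    have h4 := mul_le_mul_of_nonneg_left (hfsep z hz.mem hfar) hρ.le
    have h5 := hle (R : X →L[ℝ] W) x hx
    have h6 : 0 < ρ * ϖ := mul_pos hρ hϖ
    linarith
  · have hnormalize : ‖‖(R : X →L[ℝ] W)‖⁻¹ • (R : X →L[ℝ] W) - R‖ = |‖(R : X →L[ℝ] W)‖ - 1| := by
      have : ‖(R : X →L[ℝ] W)‖⁻¹ • (R : X →L[ℝ] W) - R =
          (‖(R : X →L[ℝ] W)‖⁻¹ - 1) • (R : X →L[ℝ] W) := by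
        rw [sub_smul, one_smul]
      rw [this, norm_smul, Real.norm_eq_abs, abs_sub_comm, ← abs_of_pos hRpos, ← abs_mul,
        abs_of_pos hRpos, sub_mul, one_mul, inv_mul_cancel₀ hRpos.ne']
    calc ‖‖(R : X →L[ℝ] W)‖⁻¹ • (R : X →L[ℝ] W) - T‖
        ≤ ‖‖(R : X →L[ℝ] W)‖⁻¹ • (R : X →L[ℝ] W) - R‖ + ‖(R : X →L[ℝ] W) - T‖ :=
          norm_sub_le_norm_sub_add_norm_sub _ _ _
      _ < ε := by rw [hnormalize]; linarith

end Operators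

theorem corollary3p13
    {X : Type*} [NormedAddCommGroup X] [NormedSpace ℝ X] [CompleteSpace X]
    (A : Set X) (hA_sphere : A ⊆ Metric.sphere (0 : X) 1) (hA_closed : IsClosed A)
    (hA_hull : Metric.closedBall (0 : X) 1 ⊆ closure (absConvexHull ℝ A))
    (hA_sep : ∃ ε₀ : ℝ, 0 < ε₀ ∧ ∀ ε : ℝ, 0 < ε → ε < ε₀ →
      ∃ ϖ : ℝ, 0 < ϖ ∧ ∀ x ∈ A, ∃ f : X →L[ℝ] ℝ, ‖f‖ ≤ 1 ∧
        ∀ z ∈ A, ε ≤ ‖z - x‖ → |f z| ≤ f x - ϖ)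
    {W : Type*} [NormedAddCommGroup W] [NormedSpace ℝ W] [CompleteSpace W] [Nontrivial W]
    (𝒜 : Submodule ℝ (X →L[ℝ] W)) (h𝒜_closed : IsClosed (𝒜 : Set (X →L[ℝ] W)))
    (h𝒜_finiteRank : ∀ F : X →L[ℝ] W,
      FiniteDimensional ℝ (LinearMap.range (F : X →ₗ[ℝ] W)) → F ∈ 𝒜) :
    (∀ S : X →L[ℝ] W,
      IsSigmaPorous {T : 𝒜 | AttainsStronglyNorm (S + (T : X →L[ℝ] W)) A}ᶜ) ∧
    (∀ ε : ℝ, 0 < ε → ∃ η : ℝ, 0 < η ∧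
      ∀ T ∈ 𝒜, ‖T‖ = 1 → ∀ x ∈ A, 1 - η < ‖T x‖ →
        ∃ S ∈ 𝒜, ‖S‖ = 1 ∧ ∃ z ∈ A, ‖S z‖ = 1 ∧ ‖x - z‖ < ε ∧ ‖S - T‖ < ε) := by
  have hporous := isSigmaPorous_compl_attainsStronglyNorm hA_sphere hA_closed hA_hull hA_sep
    h𝒜_finiteRank
  refine ⟨hporous, fun ε hε => ?_⟩
  have : CompleteSpace 𝒜 := h𝒜_closed.completeSpace_coe
  have hdense : Dense {T : 𝒜 | AttainsStronglyNorm (T : X →L[ℝ] W) A} := by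
    simpa using (hporous 0).dense_compl
  obtain ⟨ε₀, hε₀, H⟩ := hA_sep
  -- Separation is available only below `ε₀`, so large `ε` are reduced to a smaller scale.
  have hδ : 0 < min ε (ε₀ / 2) := by positivity
  obtain ⟨ϖ, hϖ, hsep⟩ := H _ hδ ((min_le_right _ _).trans_lt (half_lt_self hε₀))
  obtain ⟨η, hη, hnear⟩ := exists_normAttaining_near hA_sphere h𝒜_finiteRank hdense hδ hϖ hsep
  refine ⟨η, hη, fun T hT hT1 x hx hTx => ?_⟩
  obtain ⟨S, hS, hS1, z, hz, hSz, hxz, hST⟩ := hnear T hT hT1 x hx hTx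
  exact ⟨S, hS, hS1, z, hz, hSz, hxz.trans_le (min_le_left _ _), hST.trans_le (min_le_left _ _)⟩
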